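/- Let $n\ge 3$ and let $C=(c_{ij})$ be the $n\times n$ Cartan matrix of type $\widetilde{C}_{n-1}$: $c_{ii}=2$ for all $i$, $c_{21}=c_{n-1,n}=-2$, all other entries $c_{ij}$ with $|i-j|=1$ equal $-1$, and $c_{ij}=0$ if $|i-j|\ge 2$. Let $\alpha_1,\dots,\alpha_n$ be the standard basis of $\mathbb{Z}^n$ (the simple roots), let $s_i$ be the automorphism of $\mathbb{Z}^n$ with $s_i(\alpha_j)=\alpha_j-c_{ij}\alpha_i$, let $W$ be the group generated by $s_1,\dots,s_n$, and put $\delta=(1,2,\dots,2,1)$. The set of roots is $\Delta=\bigcup_{i} W(\alpha_i)\cup(\mathbb{Z}\setminus\{0\})\delta$, and the set of positive roots is $\Delta^+=\Delta\cap\mathbb{Z}_{\ge 0}^n$. Let $\Omega$ be an orientation of $C$, that is, a subset of $\{1,\dots,n\}^2$ such that $\{(i,j),(j,i)\}\cap\Omega\neq\emptyset$ if and only if $c_{ij}<0$, and such that the quiver $Q^0$ with vertices $1,\dots,n$ and one arrow $i\to j$ for each $(j,i)\in\Omega$ has no oriented cycle. A vertex is called admissible if it is a sink or a source of $Q^0$,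 and $Q^0$ is called alternating if every vertex is admissible. For a vertex $i$ let $s_i(\Omega)$ be the orientation obtained by reversing all arrows at $i$. Let $\mathbf{i}=(i_1,\dots,i_n)$ be a $+$-admissible sequence for $(C,\Omega)$: $\{i_1,\dots,i_n\}=\{1,\dots,n\}$, $i_1$ is a sink for $\Omega$, and $i_k$ is a sink for $s_{i_{k-1}}\cdots s_{i_1}(\Omega)$ for $2\le k\le n$. Put $$c=s_{i_n}\cdots s_{i_1},\qquad \beta_{\mathbf{i},k}=s_{i_1}\cdots s_{i_{k-1}}(\alpha_{i_k}),\qquad \gamma_{\mathbf{i},k}=s_{i_n}\cdots s_{i_{k+1}}(\alpha_{i_k}).$$ If $Q^0$ is alternating, let $\alpha$ be any of the vectors $\alpha_i+\alpha_{i+1}$ with $1\le i\le n-1$; otherwise let $\alpha$ be any simple root $\alpha_l$ at a non-admissible vertex $l$. Then $$\begin{aligned}\Delta^+={}&\{c^{-r}(\beta_{\mathbf{i},k})\mid r\in\mathbb{Z}_{\ge0},\ 1\le k\le n\}\cup\{c^{s}(\gamma_{\mathbf{i},k})\mid s\in\mathbb{Z}_{\ge0},\ 1\le k\le n\}\\&\cup\Big\{\sum_{p\le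 j\le p+q}c^{j}(\alpha)+m\delta\ \Big|\ 0\le p<n-1,\ 0\le q<n-2,\ m\in\mathbb{Z}_{\ge0}\Big\}\cup\mathbb{Z}_{>0}\delta.\end{aligned}$$ -/

import Mathlib

namespace AffineC

/-- The `n × n` Cartan matrix `C` of type `C̃_{n-1}` (meant for `3 ≤ n`). Rows and columns are
indexed by `0, …, n - 1` in place of `1, …, n`. -/
def cartanMatrix (n : ℕ) : Matrix (Fin n) (Fin n) ℤ := Matrix.of fun i j =>
  if i = j then 2
  else if (i.val = 1 ∧ j.val = 0) ∨ (i.val + 2 = n ∧ j.val + 1 = n) then -2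
  else if i.val + 1 = j.val ∨ j.val + 1 = i.val then -1
  else 0

/-- The simple root `α_i`, the `i`-th standard basis vector of the root lattice `ℤⁿ`. -/
def simpleRoot {n : ℕ} (i : Fin n) : Fin n → ℤ := Pi.single i 1

/-- The linear form `x ↦ ∑ j, c_{ij} x_j` on the root lattice. -/
def coroot {n : ℕ} (i : Fin n) : Module.Dual ℤ (Fin n → ℤ) :=
  LinearMap.proj i ∘ₗ (cartanMatrix n).mulVecLin

theorem coroot_simpleRoot {n : ℕ} (i j : Fin n) :
    coroot i (simpleRoot j) = cartanMatrix n i j := by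
  simp [coroot, simpleRoot]

theorem coroot_simpleRoot_self {n : ℕ} (i : Fin n) : coroot i (simpleRoot i) = 2 := by
  simp [coroot_simpleRoot, cartanMatrix]

/-- The simple reflection `s_i` of the root lattice. -/
def simpleReflection {n : ℕ} (i : Fin n) : (Fin n → ℤ) ≃ₗ[ℤ] (Fin n → ℤ) :=
  Module.reflection (coroot_simpleRoot_self i)

/-- `s_i(α_j) = α_j - c_{ij} α_i`. -/
theorem simpleReflection_simpleRoot {n : ℕ} (i j : Fin n) :
    simpleReflection i (simpleRoot j) = simpleRoot j - cartanMatrix n i j • simpleRoot i := by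
  rw [simpleReflection, Module.reflection_apply, coroot_simpleRoot]

/-- The Weyl group `W`, generated by the simple reflections inside `Aut(ℤⁿ)`. -/
def weylGroup (n : ℕ) : Subgroup ((Fin n → ℤ) ≃ₗ[ℤ] (Fin n → ℤ)) :=
  Subgroup.closure (Set.range simpleReflection)

/-- The minimal positive imaginary root `δ = (1, 2, …, 2, 1)`. -/
def delta (n : ℕ) : Fin n → ℤ := fun i => if i.val = 0 ∨ i.val + 1 = n then 1 else 2

/-- Real roots: the orbits of the simple roots under the Weyl group. -/
def realRoots (n : ℕ) : Set (Fin n → ℤ) :=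
  {x | ∃ w ∈ weylGroup n, ∃ i : Fin n, x = w (simpleRoot i)}

/-- Imaginary roots: the non-zero integer multiples of `δ` (zero is not a root). -/
def imaginaryRoots (n : ℕ) : Set (Fin n → ℤ) :=
  {x | ∃ m : ℤ, m ≠ 0 ∧ x = m • delta n}

/-- Positive roots: the roots, real or imaginary, all of whose coordinates are nonnegative. -/
def positiveRoots (n : ℕ) : Set (Fin n → ℤ) :=
  {x | x ∈ realRoots n ∪ imaginaryRoots n ∧ ∀ i, 0 ≤ x i}

/-- Orientations of the Cartan matrix. A pair `(j, i) ∈ Ω` stands for an arrow `i → j` of the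
quiver `Q⁰` (all entries of the matrix have `gcd (|c_{ij}|, |c_{ji}|) = 1` when `c_{ij} < 0` and
`3 ≤ n`, so arrows are simple). The second condition says that there is no oriented cycle. -/
structure IsOrientation {n : ℕ} (Ω : Set (Fin n × Fin n)) : Prop where
  adj_iff : ∀ i j : Fin n, ((i, j) ∈ Ω ∨ (j, i) ∈ Ω) ↔ cartanMatrix n i j < 0
  acyclic : ∀ i : Fin n, ¬ Relation.TransGen (fun a b => (a, b) ∈ Ω) i i

/-- `i` is a sink of `Q⁰`: there is no arrow `i → j`. -/
def IsSink {n : ℕ} (Ω : Set (Fin n × Fin n)) (i : Fin n) : Prop := ∀ j, (j, i) ∉ Ω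

/-- `i` is a source of `Q⁰`: there is no arrow `j → i`. -/
def IsSource {n : ℕ} (Ω : Set (Fin n × Fin n)) (i : Fin n) : Prop := ∀ j, (i, j) ∉ Ω

/-- A vertex is admissible if it is a sink or a source of `Q⁰`. -/
def IsAdmissible {n : ℕ} (Ω : Set (Fin n × Fin n)) (i : Fin n) : Prop :=
  IsSink Ω i ∨ IsSource Ω i

/-- The orientation `s_i(Ω)`: all arrows at the vertex `i` are reversed. -/
def reflectOrientation {n : ℕ} (i : Fin n) (Ω : Set (Fin n × Fin n)) : Set (Fin n × Fin n) :=
  {a | a ∈ Ω ∧ a.1 ≠ i ∧ a.2 ≠ i} ∪ {a | (a.2, a.1) ∈ Ω ∧ (a.1 = i ∨ a.2 = i)}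

/-- The `+`-admissible sequences: every vertex occurs, and the `k`-th entry is a sink for the
orientation obtained from `Ω` by reflecting successively at all the earlier entries. -/
structure IsPlusAdmissible {n : ℕ} (Ω : Set (Fin n × Fin n)) (i : Fin n → Fin n) : Prop where
  surjective : Function.Surjective i
  sink : ∀ k : Fin n,
    IsSink (((List.ofFn i).take k.val).foldl (fun Ω' v => reflectOrientation v Ω') Ω) (i k)

/-- `β_{i,k} = s_{i_1} s_{i_2} ⋯ s_{i_{k-1}} (α_{i_k})`. -/
def beta {n : ℕ} (i : Fin n → Fin n) (k : Fin n) : Fin n → ℤ :=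
  (((List.ofFn i).take k.val).map simpleReflection).prod (simpleRoot (i k))

/-- `γ_{i,k} = s_{i_n} s_{i_{n-1}} ⋯ s_{i_{k+1}} (α_{i_k})`. -/
def gamma {n : ℕ} (i : Fin n → Fin n) (k : Fin n) : Fin n → ℤ :=
  (((List.ofFn i).drop (k.val + 1)).reverse.map simpleReflection).prod (simpleRoot (i k))

/-- The Coxeter transformation `c_i = s_{i_n} s_{i_{n-1}} ⋯ s_{i_1}`. -/
def coxeter {n : ℕ} (i : Fin n → Fin n) : (Fin n → ℤ) ≃ₗ[ℤ] (Fin n → ℤ) :=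
  ((List.ofFn i).reverse.map simpleReflection).prod

/-- The allowed choices of `α`: any `α_i + α_{i+1}` if `Q⁰` is alternating, that is, if every
vertex is admissible, and otherwise any simple root at a non-admissible vertex. -/
def IsTubeRoot {n : ℕ} (Ω : Set (Fin n × Fin n)) (α : Fin n → ℤ) : Prop :=
  ((∀ l, IsAdmissible Ω l) ∧
    ∃ i j : Fin n, j.val = i.val + 1 ∧ α = simpleRoot i + simpleRoot j) ∨
  ∃ l, ¬ IsAdmissible Ω l ∧ α = simpleRoot l

end AffineC

/-! Unfold the diagram to the doubly infinite path `ℤ` by folding with period `2 (n - 1)` and the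
symmetry `k ↦ -k`. Let `eps` be a sequence of lattice vectors whose step at `k` is the simple root
below `k`. On differences of `eps`, each simple reflection acts through a permutation of `ℤ` made of
adjacent swaps (`simpleReflection_eps`), and the positive roots are exactly the `eps y - eps x` with
`x < y` (`positiveRoots_eq`). The mirror `x ↦ 1 - x` gives the same root for `(x, y)` and `(1 - y, 1
- x)`.

The Coxeter element moves each rising integer right to the next rising one (`coxPerm_rising`) and,
by the mirror, each other integer left. So positive roots split by the kinds of their ends. If a
rising `x` precedes a non-rising `y`, the ends approach under `c` until they cross, and the roots
about to cross are the `beta`. The opposite pattern gives `gamma` by reversing the sequence. Ends of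
equal kind may both be taken rising; these roots are sums of consecutive steps of one `c`-orbit, and
`n - 1` steps make one period, that is `δ` (`coxPerm_pow_period`, `setOf_tube`). -/

namespace AffineC

/-! ### Folding the doubly infinite path onto the diagram -/

section

variable {n : ℕ} [h3 : Fact (3 ≤ n)]

/-- The period `2 (n - 1)` of the unfolded diagram. -/
def period (n : ℕ) : ℕ := 2 * (n - 1)

/-- The folding of the doubly infinite path onto the diagram of type `C̃_{n-1}`:
it has period `2 (n - 1)` and identifies `k` with `-k`. -/
def foldVertex (n : ℕ) [h3 : Fact (3 ≤ n)] (k : ℤ) : Fin n :=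
  ⟨(k.bmod (period n)).natAbs, by
    have h := h3.out
    have h0 : 0 < period n := by unfold period; omega
    have h1 := Int.le_bmod (x := k) h0
    have h2 := Int.bmod_lt (x := k) h0
    unfold period at *
    omega⟩

theorem foldVertex_add_mul_val (r q : ℤ) (h1 : -((n : ℤ) - 1) ≤ r) (h2 : r ≤ (n : ℤ) - 1) :
    (foldVertex n (r + period n * q)).val = r.natAbs := by
  have h := h3.out
  change ((r + period n * q).bmod (period n)).natAbs = _
  rw [Int.add_mul_bmod_self_left]
  rcases eq_or_lt_of_le h2 with h2 | h2
  -- The balanced remainder lies in `[-(n - 1), n - 1)`, so `n - 1` is represented by `-(n - 1)`, of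
  -- equal absolute value.
  · have : r = (-(n - 1 : ℤ)) + period n * 1 := by unfold period; push_cast; omega
    rw [this, Int.add_mul_bmod_self_left, Int.bmod_eq_of_le] <;> unfold period <;> push_cast <;>
      omega
  · rw [Int.bmod_eq_of_le] <;> unfold period <;> omega

/-- Using the balanced remainder of `-k` makes the interval open on the left, so that `r - 1` also
stays in the range of `foldVertex_add_mul_val`. -/
theorem exists_eq_add_mul (k : ℤ) :
    ∃ r q : ℤ, k = r + period n * q ∧ -((n : ℤ) - 1) < r ∧ r ≤ (n : ℤ) - 1 := by
  have h := h3.out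
  have h0 : 0 < period n := by unfold period; omega
  have h1 := Int.le_bmod (x := -k) h0
  have h2 := Int.bmod_lt (x := -k) h0
  obtain ⟨q, hq⟩ := Int.dvd_self_sub_bmod (x := -k) (m := period n)
  refine ⟨-(-k).bmod (period n), -q, ?_, ?_, ?_⟩
  · rw [mul_neg, ← hq]; ring
  · unfold period at *; omega
  · unfold period at *; omega

theorem foldVertex_natCast (v : Fin n) : foldVertex n (v.val : ℤ) = v := by
  have h := h3.out
  apply Fin.ext
  have := foldVertex_add_mul_val (n := n) (v.val : ℤ) 0 (by omega) (by omega)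
  simpa using this

theorem foldVertex_val_of_lt (k : ℕ) (hk : k < n) : (foldVertex n (k : ℤ)).val = k :=
  congrArg Fin.val (foldVertex_natCast ⟨k, hk⟩)

theorem foldVertex_neg (k : ℤ) : foldVertex n (-k) = foldVertex n k := by
  apply Fin.ext
  obtain ⟨r, q, rfl, h1, h2⟩ := exists_eq_add_mul (n := n) k
  rw [show -(r + period n * q) = -r + period n * (-q) by ring,
    foldVertex_add_mul_val _ _ (by omega) (by omega),
    foldVertex_add_mul_val _ _ (by omega) (by omega), Int.natAbs_neg]

theorem foldVertex_add_mul (k q : ℤ) : foldVertex n (k + period n * q) = foldVertex n k := by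
  apply Fin.ext
  simp only [foldVertex, Int.add_mul_bmod_self_left]

theorem foldVertex_eq_iff (k l : ℤ) :
    foldVertex n k = foldVertex n l ↔ (period n : ℤ) ∣ k - l ∨ (period n : ℤ) ∣ k + l := by
  constructor
  · intro h
    have h' := congrArg Fin.val h
    obtain ⟨r, q, rfl, h1, h2⟩ := exists_eq_add_mul (n := n) k
    obtain ⟨s, p, rfl, h4, h5⟩ := exists_eq_add_mul (n := n) l
    rw [foldVertex_add_mul_val _ _ (by omega) (by omega),
      foldVertex_add_mul_val _ _ (by omega) (by omega), Int.natAbs_eq_natAbs_iff] at h'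
    rcases h' with rfl | rfl
    · exact Or.inl ⟨q - p, by ring⟩
    · exact Or.inr ⟨q + p, by ring⟩
  · rintro (⟨q, hq⟩ | ⟨q, hq⟩)
    · rw [show k = l + period n * q by linarith, foldVertex_add_mul]
    · rw [show k = -l + period n * q by linarith, foldVertex_add_mul, foldVertex_neg]

/-- The folding maps neighbours to neighbours, and is a local isomorphism away from the ends. -/
theorem foldVertex_neighbours (k : ℤ) :
    ((foldVertex n k).val = 0 ∧ (foldVertex n (k - 1)).val = 1 ∧ (foldVertex n (k + 1)).val = 1) ∨
    ((foldVertex n k).val + 1 = n ∧ (foldVertex n (k - 1)).val + 2 = n ∧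
      (foldVertex n (k + 1)).val + 2 = n) ∨
    (0 < (foldVertex n k).val ∧ (foldVertex n k).val + 1 < n ∧
      (((foldVertex n (k - 1)).val + 1 = (foldVertex n k).val ∧
        (foldVertex n (k + 1)).val = (foldVertex n k).val + 1) ∨
      ((foldVertex n (k - 1)).val = (foldVertex n k).val + 1 ∧
        (foldVertex n (k + 1)).val + 1 = (foldVertex n k).val))) := by
  have h := h3.out
  obtain ⟨r, q, rfl, h1, h2⟩ := exists_eq_add_mul (n := n) k
  rw [foldVertex_add_mul_val r q (by omega) (by omega),
    show r + period n * q - 1 = (r - 1) + period n * q by ring,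
    foldVertex_add_mul_val (r - 1) q (by omega) (by omega)]
  rcases eq_or_lt_of_le h2 with h2 | h2
  · have e : r + period n * q + 1 = (r + 1 - period n) + period n * (q + 1) := by ring
    rw [e, foldVertex_add_mul_val _ _ (by unfold period; omega) (by unfold period; omega)]
    unfold period; omega
  · have e : r + period n * q + 1 = (r + 1) + period n * q := by ring
    rw [e, foldVertex_add_mul_val _ _ (by omega) (by omega)]
    omega

theorem foldVertex_succ_ne (k : ℤ) : foldVertex n (k + 1) ≠ foldVertex n k := by
  intro h
  have := foldVertex_neighbours (n := n) k
  rw [h] at this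
  omega

theorem foldVertex_pred_ne (k : ℤ) : foldVertex n (k - 1) ≠ foldVertex n k := by
  intro h
  have := foldVertex_neighbours (n := n) k
  rw [h] at this
  omega

/-- At an end of the diagram both neighbours of `k` fold to the same vertex; the two contributions
add up to the entry `-2`. -/
theorem cartanMatrix_foldVertex (v : Fin n) (k : ℤ) :
    cartanMatrix n v (foldVertex n k) = (if foldVertex n k = v then 2 else 0) -
      (if foldVertex n (k - 1) = v then 1 else 0) - (if foldVertex n (k + 1) = v then 1 else 0) := by
  have h := h3.out
  have h1 := foldVertex_neighbours (n := n) k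
  simp only [cartanMatrix, Matrix.of_apply, Fin.ext_iff]
  split_ifs <;> omega

/-! ### Simple reflections as permutations of the integers -/

/-- The simple reflection at `v` as a permutation of the integers, exchanging `k` and `k + 1`
for every `k` above `v`. -/
def swapFun (v : Fin n) (x : ℤ) : ℤ :=
  if foldVertex n x = v then x + 1 else if foldVertex n (x - 1) = v then x - 1 else x

theorem swapFun_involutive (v : Fin n) : Function.Involutive (swapFun v) := by
  intro x
  by_cases h : foldVertex n x = v
  · have h1 := foldVertex_succ_ne (n := n) x
    rw [h] at h1
    simp [swapFun, h, h1]
  · by_cases h' : foldVertex n (x - 1) = v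
    · simp [swapFun, h, h']
    · simp [swapFun, h, h']

/-- `swapFun` as a permutation. -/
def swapPerm (v : Fin n) : Equiv.Perm ℤ := (swapFun_involutive v).toPerm

theorem swapPerm_apply (v : Fin n) (x : ℤ) : swapPerm v x =
    if foldVertex n x = v then x + 1 else if foldVertex n (x - 1) = v then x - 1 else x := rfl

theorem swapPerm_inv (v : Fin n) : (swapPerm v)⁻¹ = swapPerm v := rfl

/-- The mirror carries the pair `{k, k + 1}` to `{-k, 1 - k}`, and `k`, `-k` fold to the same
vertex. -/
theorem swapPerm_mirror (v : Fin n) (x : ℤ) : swapPerm v (1 - x) = 1 - swapPerm v x := by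
  have h1 : foldVertex n (1 - x) = foldVertex n (x - 1) := by rw [← foldVertex_neg]; ring_nf
  have h2 : foldVertex n (1 - x - 1) = foldVertex n x := by rw [← foldVertex_neg]; ring_nf
  have h3 := foldVertex_pred_ne (n := n) x
  simp only [swapPerm_apply, h1, h2]
  split_ifs with h4 h5
  · exact absurd (h4.trans h5.symm) h3
  all_goals ring

theorem swapPerm_add_mul (v : Fin n) (x q : ℤ) :
    swapPerm v (x + period n * q) = swapPerm v x + period n * q := by
  have h2 : foldVertex n (x + period n * q - 1) = foldVertex n (x - 1) := by
    rw [← foldVertex_add_mul (x - 1) q]; ring_nf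
  simp only [swapPerm_apply, foldVertex_add_mul, h2]
  split_ifs <;> ring

/-! ### Lattice vectors attached to integers -/

/-- The sequence with differences `f`, vanishing at `0`. -/
def potential {A : Type*} [AddCommGroup A] (f : ℤ → A) (x : ℤ) : A :=
  ∑ j ∈ Finset.range x.toNat, f j - ∑ j ∈ Finset.range (-x).toNat, f (-1 - j)

theorem potential_succ {A : Type*} [AddCommGroup A] (f : ℤ → A) (x : ℤ) :
    potential f (x + 1) = potential f x + f x := by
  rcases le_or_gt 0 x with h | h
  · lift x to ℕ using h
    have h1 : ((x : ℤ) + 1).toNat = x + 1 := by omega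
    have h2 : (-((x : ℤ) + 1)).toNat = 0 := by omega
    have h3 : (-(x : ℤ)).toNat = 0 := by omega
    simp only [potential, h1, h2, h3, Finset.sum_range_succ, Int.toNat_natCast]
    simp
  · obtain ⟨m, rfl⟩ : ∃ m : ℕ, x = -1 - m := ⟨(-1 - x).toNat, by omega⟩
    have h1 : (-1 - (m : ℤ) + 1).toNat = 0 := by omega
    have h2 : (-(-1 - (m : ℤ) + 1)).toNat = m := by omega
    have h3 : (-1 - (m : ℤ)).toNat = 0 := by omega
    have h4 : (-(-1 - (m : ℤ))).toNat = m + 1 := by omega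
    simp only [potential, h1, h2, h3, h4, Finset.sum_range_succ]
    simp

/-- The vector with `eps (x + 1) - eps x` equal to the simple root below `x`, and `eps 0 = 0`. -/
def eps (n : ℕ) [h3 : Fact (3 ≤ n)] (x : ℤ) : Fin n → ℤ :=
  potential (fun k => simpleRoot (foldVertex n k)) x

theorem eps_succ (x : ℤ) : eps n (x + 1) = eps n x + simpleRoot (foldVertex n x) :=
  potential_succ _ x

theorem const_of_succ_eq {A : Type*} (f : ℤ → A) (h : ∀ x, f (x + 1) = f x) (x : ℤ) :
    f x = f 0 := by
  induction x using Int.induction_on with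
  | zero => rfl
  | succ i ih => rw [h, ih]
  | pred i ih => rw [← ih, ← h (-(i : ℤ) - 1)]; ring_nf

/-- Only differences of `eps` matter, so identities between them are checked one unit step at a
time. -/
theorem sub_eq_sub_of_succ {A : Type*} [AddCommGroup A] (f g : ℤ → A)
    (h : ∀ x, f (x + 1) - f x = g (x + 1) - g x) (x y : ℤ) : f y - f x = g y - g x := by
  have h' := const_of_succ_eq (fun x => f x - g x) fun x => by
    rw [sub_eq_sub_iff_sub_eq_sub]; exact h x
  rw [sub_eq_sub_iff_sub_eq_sub, h' y, h' x]

theorem eps_mirror (x y : ℤ) : eps n (1 - y) - eps n (1 - x) = eps n x - eps n y := by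
  rw [← neg_sub (eps n y)]
  have := sub_eq_sub_of_succ (fun x => eps n (1 - x)) (fun x => -eps n x) (fun x => by
    have h1 := eps_succ (n := n) (-x)
    rw [foldVertex_neg] at h1
    rw [show 1 - (x + 1) = -x by ring, eps_succ, show 1 - x = -x + 1 by ring, h1]
    abel) x y
  rw [this]; abel

theorem eps_add_mul_sub (x y q : ℤ) :
    eps n (y + period n * q) - eps n (x + period n * q) = eps n y - eps n x :=
  sub_eq_sub_of_succ (fun x => eps n (x + period n * q)) (eps n) (fun x => by
    rw [show x + 1 + period n * q = x + period n * q + 1 by ring, eps_succ, eps_succ,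
      foldVertex_add_mul]
    abel) x y

theorem simpleReflection_eps (v : Fin n) (x y : ℤ) :
    simpleReflection v (eps n y - eps n x) = eps n (swapPerm v y) - eps n (swapPerm v x) := by
  rw [map_sub]
  refine sub_eq_sub_of_succ (fun x => simpleReflection v (eps n x)) (fun x => eps n (swapPerm v x))
    (fun x => ?_) x y
  have h0 := foldVertex_pred_ne (n := n) x
  have h1 := foldVertex_succ_ne (n := n) x
  have e1 := eps_succ (n := n) x
  have e2 := eps_succ (n := n) (x + 1)
  have e3 := eps_succ (n := n) (x - 1)
  rw [sub_add_cancel] at e3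
  rw [← map_sub, e1, add_sub_cancel_left, simpleReflection_simpleRoot, cartanMatrix_foldVertex]
  simp only [swapPerm_apply, add_sub_cancel_right]
  by_cases a : foldVertex n x = v
  · subst a
    simp only [h0, h1, if_true, if_false, e1]
    module
  · by_cases b : foldVertex n (x - 1) = v <;> by_cases c : foldVertex n (x + 1) = v <;>
      simp only [a, b, c, if_true, if_false, e1, e2, e3] <;> module

theorem eps_le_of_le {x y : ℤ} (h : x ≤ y) (i : Fin n) : eps n x i ≤ eps n y i := by
  induction y, h using Int.leInduction with
  | base => rfl
  | succ k _ ih =>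
    rw [eps_succ]
    have : 0 ≤ simpleRoot (foldVertex n k) i := by
      unfold simpleRoot; rw [Pi.single_apply]; split_ifs <;> simp
    simp only [Pi.add_apply]; omega

theorem exists_eps_lt {x y : ℤ} (h : x < y) : ∃ i : Fin n, eps n x i < eps n y i := by
  refine ⟨foldVertex n x, lt_of_lt_of_le ?_ (eps_le_of_le (Int.add_one_le_of_lt h) _)⟩
  simp [eps_succ, simpleRoot]

theorem lt_of_eps_sub_nonneg {x y : ℤ} (hxy : x ≠ y) (h : ∀ i : Fin n, 0 ≤ (eps n y - eps n x) i) :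
    x < y := by
  by_contra! h'
  obtain ⟨i, hi⟩ := exists_eps_lt (n := n) (lt_of_le_of_ne h' hxy.symm)
  have := h i
  simp only [Pi.sub_apply] at this
  omega

/-- The window `[-(n - 1), n - 1)` meets each inner vertex twice and each end once, which are the
coefficients of `δ`. -/
theorem eps_period (x : ℤ) : eps n (x + period n) - eps n x = delta n := by
  have h := h3.out
  have e : eps n (x + period n) - eps n x = eps n ((n - 1 : ℕ) : ℤ) - eps n (-((n - 1 : ℕ) : ℤ)) := by
    have := sub_eq_sub_of_succ (fun x => eps n (x + period n)) (eps n) (fun x => by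
      have := foldVertex_add_mul (n := n) x 1
      rw [mul_one] at this
      rw [show x + 1 + period n = x + period n + 1 by ring, eps_succ, eps_succ, this]
      abel) (-((n - 1 : ℕ) : ℤ)) x
    rw [show ((n - 1 : ℕ) : ℤ) = -((n - 1 : ℕ) : ℤ) + period n by unfold period; push_cast; ring]
    rw [sub_eq_sub_iff_sub_eq_sub, this]
    congr 2; unfold period; push_cast; ring
  rw [e]
  have h1 : (-((n - 1 : ℕ) : ℤ)).toNat = 0 := by omega
  have h2 : (- -((n - 1 : ℕ) : ℤ)).toNat = n - 1 := by omega
  simp only [eps, potential, h1, h2, Int.toNat_natCast, Finset.range_zero, Finset.sum_empty, sub_zero, zero_sub,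
    sub_neg_eq_add]
  ext i
  have h5 : ∀ j ∈ Finset.range (n - 1), simpleRoot (foldVertex n (j : ℤ)) i =
      if j = i.val then 1 else 0 := by
    intro j hj
    rw [Finset.mem_range] at hj
    have := foldVertex_val_of_lt (n := n) j (by omega)
    simp only [simpleRoot, Pi.single_apply, Fin.ext_iff, this, eq_comm]
  have h6 : ∀ j ∈ Finset.range (n - 1), simpleRoot (foldVertex n (-1 - j : ℤ)) i =
      if i.val = j + 1 then 1 else 0 := by
    intro j hj
    rw [Finset.mem_range] at hj
    have := foldVertex_val_of_lt (n := n) (j + 1) (by omega)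
    rw [← foldVertex_neg] at this
    rw [show -1 - (j : ℤ) = -((j + 1 : ℕ) : ℤ) by push_cast; ring]
    simp only [simpleRoot, Pi.single_apply, Fin.ext_iff, this]
  have h7 : ∑ j ∈ Finset.range (n - 1), (if i.val = j + 1 then (1 : ℤ) else 0) =
      if i.val = 0 then 0 else 1 := by
    split_ifs with h0
    · exact Finset.sum_eq_zero fun j _ => by rw [if_neg (by omega)]
    · rw [Finset.sum_eq_single (i.val - 1) (fun j _ hj => if_neg (by omega))
        (fun hj => by rw [Finset.mem_range] at hj; omega), if_pos (by omega)]
  simp only [Pi.add_apply, Finset.sum_apply]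
  rw [Finset.sum_congr rfl h5, Finset.sum_congr rfl h6, h7, Finset.sum_ite_eq', delta]
  simp only [Finset.mem_range]
  split_ifs <;> omega

theorem eps_add_period_mul (x q : ℤ) : eps n (x + period n * q) - eps n x = q • delta n := by
  have h := sub_eq_sub_of_succ (fun q : ℤ => eps n (x + period n * q)) (fun q : ℤ => q • delta n)
    (fun q => by
      rw [show x + period n * (q + 1) = x + period n * q + period n by ring, eps_period]
      module) 0 q
  simpa using h

end

/-! ### Positive roots as differences -/

theorem realRoots_of_simpleReflection {n : ℕ} {v : Fin n} {x : Fin n → ℤ}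
    (h : simpleReflection v x ∈ realRoots n) : x ∈ realRoots n := by
  obtain ⟨w, hw, i, hi⟩ := h
  refine ⟨simpleReflection v * w, mul_mem (Subgroup.subset_closure ⟨v, rfl⟩) hw, i, ?_⟩
  rw [LinearEquiv.mul_apply, ← hi]
  exact (Module.involutive_reflection (coroot_simpleRoot_self v) x).symm

section

variable {n : ℕ} [h3 : Fact (3 ≤ n)]

theorem simpleRoot_eq_eps (k : ℤ) :
    simpleRoot (foldVertex n k) = eps n (k + 1) - eps n k := by
  rw [eps_succ, add_sub_cancel_left]

theorem exists_weylGroup_apply_eps {w : (Fin n → ℤ) ≃ₗ[ℤ] (Fin n → ℤ)} (hw : w ∈ weylGroup n) :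
    ∃ τ : Equiv.Perm ℤ, ∀ x y, w (eps n y - eps n x) = eps n (τ y) - eps n (τ x) := by
  induction hw using Subgroup.closure_induction with
  | mem x hx =>
    obtain ⟨v, rfl⟩ := hx
    exact ⟨swapPerm v, simpleReflection_eps v⟩
  | one => exact ⟨1, fun x y => rfl⟩
  | mul u v _ _ hu hv =>
    obtain ⟨τ, hτ⟩ := hu
    obtain ⟨ρ, hρ⟩ := hv
    exact ⟨τ * ρ, fun x y => by
      rw [LinearEquiv.mul_apply, hρ, hτ, Equiv.Perm.mul_apply, Equiv.Perm.mul_apply]⟩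
  | inv u _ hu =>
    obtain ⟨τ, hτ⟩ := hu
    refine ⟨τ⁻¹, fun x y => ?_⟩
    have := hτ (τ⁻¹ x) (τ⁻¹ y)
    simp only [Equiv.Perm.coe_inv, Equiv.apply_symm_apply] at this
    exact (LinearEquiv.symm_apply_eq _).2 this.symm

theorem swapPerm_dvd_sub_iff (v : Fin n) (x y : ℤ) :
    (period n : ℤ) ∣ swapPerm v y - swapPerm v x ↔ (period n : ℤ) ∣ y - x := by
  have key : ∀ x y : ℤ, (period n : ℤ) ∣ y - x →
      (period n : ℤ) ∣ swapPerm v y - swapPerm v x := by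
    rintro x y ⟨q, hq⟩
    rw [show y = x + period n * q by linarith, swapPerm_add_mul]
    exact ⟨q, by ring⟩
  refine ⟨fun h => ?_, key x y⟩
  have := key _ _ h
  rwa [show ∀ x, swapPerm v (swapPerm v x) = x from swapFun_involutive v,
    show ∀ x, swapPerm v (swapPerm v x) = x from swapFun_involutive v] at this

/-- A simple reflection brings the two ends closer, down to a simple root. Multiples of the period
are excluded, being the imaginary roots. -/
theorem eps_sub_mem_realRoots (m : ℕ) : ∀ x y : ℤ, y - x = m → ¬ (period n : ℤ) ∣ y - x →
    eps n y - eps n x ∈ realRoots n := by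
  have h := h3.out
  induction m using Nat.strong_induction_on with
  | _ m ih =>
    intro x y hm hd
    obtain rfl | rfl | hm2 : m = 0 ∨ m = 1 ∨ 2 ≤ m := by omega
    · simp [hm] at hd
    · obtain rfl : y = x + 1 := by push_cast at hm; omega
      exact ⟨1, one_mem _, foldVertex n x, by rw [← simpleRoot_eq_eps]; rfl⟩
    have key : ∀ v : Fin n, |swapPerm v y - swapPerm v x| < m → swapPerm v x < swapPerm v y →
        eps n y - eps n x ∈ realRoots n := by
      intro v h1 h2
      rw [abs_lt] at h1
      apply realRoots_of_simpleReflection (v := v)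
      rw [simpleReflection_eps]
      refine ih (swapPerm v y - swapPerm v x).toNat (by omega) _ _ (by omega) ?_
      rwa [swapPerm_dvd_sub_iff]
    have hx := foldVertex_pred_ne (n := n) x
    have hx' := foldVertex_succ_ne (n := n) x
    have hy := foldVertex_pred_ne (n := n) y
    have hxy : y = x + m := by omega
    have hxy' : y = x + 2 → foldVertex n (y - 1) ≠ foldVertex n x := by
      rintro rfl
      rwa [show x + 2 - 1 = x + 1 by ring]
    -- Reflecting at the vertex of `x` would move both ends right here, so `y` is moved left
    -- instead. This fixes `x`, since otherwise the period would divide both `x + y` and `x + y -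
    -- 2`.
    by_cases h1 : foldVertex n y = foldVertex n x
    · have h2 : foldVertex n (y - 1) ≠ foldVertex n (x - 1) := by
        rw [Ne, foldVertex_eq_iff]
        rw [foldVertex_eq_iff, or_iff_right hd] at h1
        rw [show y - 1 - (x - 1) = y - x by ring, or_iff_right hd]
        intro h2
        have h4 := dvd_sub h1 h2
        rw [show y + x - (y - 1 + (x - 1)) = 2 by ring] at h4
        have := Int.le_of_dvd (by norm_num) h4
        unfold period at this
        omega
      have e1 : swapPerm (foldVertex n (y - 1)) y = y - 1 := by
        rw [swapPerm_apply, if_neg hy.symm, if_pos rfl]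
      have e2 : swapPerm (foldVertex n (y - 1)) x = x := by
        rw [swapPerm_apply, if_neg (by rw [← h1]; exact hy.symm), if_neg h2.symm]
      apply key (foldVertex n (y - 1)) <;> rw [e1, e2]
      · rw [abs_lt]; omega
      · omega
    · have e1 : swapPerm (foldVertex n x) x = x + 1 := by
        rw [swapPerm_apply, if_pos rfl]
      have e2 : x + 1 < swapPerm (foldVertex n x) y ∧ swapPerm (foldVertex n x) y ≤ y := by
        rw [swapPerm_apply, if_neg h1]
        split_ifs with h5
        · have := mt hxy' (not_not.mpr h5)
          omega
        · omega
      apply key (foldVertex n x) <;> rw [e1]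
      · rw [abs_lt]; omega
      · exact e2.1

/-- The positive roots of type `C̃_{n-1}`, in unfolded coordinates. -/
theorem positiveRoots_eq :
    positiveRoots n = {v | ∃ x y : ℤ, x < y ∧ v = eps n y - eps n x} := by
  ext v
  constructor
  · rintro ⟨h | h, hv⟩
    · obtain ⟨w, hw, i, rfl⟩ := h
      obtain ⟨τ, hτ⟩ := exists_weylGroup_apply_eps hw
      have e : w (simpleRoot i) = eps n (τ (i.val + 1)) - eps n (τ i.val) := by
        rw [← hτ, ← simpleRoot_eq_eps, foldVertex_natCast]
      rw [e] at hv ⊢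
      refine ⟨_, _, lt_of_eps_sub_nonneg (fun h => ?_) hv, rfl⟩
      have := τ.injective h
      omega
    · obtain ⟨m, hm, rfl⟩ := h
      have h := h3.out
      rw [← eps_add_period_mul (n := n) 0 m] at hv ⊢
      refine ⟨_, _, lt_of_eps_sub_nonneg (fun h0 => ?_) hv, rfl⟩
      have : (period n : ℤ) * m = 0 := by linarith
      rcases mul_eq_zero.mp this with h1 | h1
      · unfold period at h1; omega
      · exact hm h1
  · rintro ⟨x, y, hxy, rfl⟩
    refine ⟨?_, fun i => sub_nonneg.mpr (eps_le_of_le hxy.le i)⟩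
    by_cases hd : (period n : ℤ) ∣ y - x
    · obtain ⟨q, hq⟩ := hd
      refine Or.inr ⟨q, ?_, ?_⟩
      · rintro rfl; omega
      · rw [← eps_add_period_mul x q, ← hq, add_sub_cancel]
    · exact Or.inl (eps_sub_mem_realRoots (y - x).toNat x y (by omega) hd)

end

/-! ### The Coxeter element as a permutation of the integers -/

theorem take_succ_ofFn {n : ℕ} {A : Type*} (f : Fin n → A) (k : Fin n) :
    (List.ofFn f).take (k.val + 1) = (List.ofFn f).take k.val ++ [f k] := by
  rw [← List.take_append_getElem (by simp)]
  simp

section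

variable {n : ℕ} [h3 : Fact (3 ≤ n)]

/-! The combinatorics of the Coxeter element. The vertices are ordered by a permutation `e`. -/

/-- The permutation of the integers given by the first `k` reflections of the sequence. -/
def prefixPerm (e : Equiv.Perm (Fin n)) (k : ℕ) : Equiv.Perm ℤ :=
  (((List.ofFn e).take k).map swapPerm).prod

/-- The Coxeter element as a permutation of the integers. -/
def coxPerm (e : Equiv.Perm (Fin n)) : Equiv.Perm ℤ := (prefixPerm e n)⁻¹

/-- The vertex at `x` occurs in the sequence before the vertex at `x - 1`. -/
def Rising (e : Equiv.Perm (Fin n)) (x : ℤ) : Prop :=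
  e.symm (foldVertex n x) < e.symm (foldVertex n (x - 1))

theorem prod_map_simpleReflection_eps (l : List (Fin n)) (x y : ℤ) :
    (l.map simpleReflection).prod (eps n y - eps n x) =
      eps n ((l.map swapPerm).prod y) - eps n ((l.map swapPerm).prod x) := by
  induction l with
  | nil => rfl
  | cons a l ih =>
    simp only [List.map_cons, List.prod_cons, LinearEquiv.mul_apply, Equiv.Perm.mul_apply, ih,
      simpleReflection_eps]

theorem prod_map_swapPerm_mirror (l : List (Fin n)) (x : ℤ) :
    (l.map swapPerm).prod (1 - x) = 1 - (l.map swapPerm).prod x := by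
  induction l with
  | nil => rfl
  | cons a l ih => simp only [List.map_cons, List.prod_cons, Equiv.Perm.mul_apply, ih,
      swapPerm_mirror]

theorem prod_map_swapPerm_add_mul (l : List (Fin n)) (x q : ℤ) :
    (l.map swapPerm).prod (x + period n * q) = (l.map swapPerm).prod x + period n * q := by
  induction l with
  | nil => rfl
  | cons a l ih => simp only [List.map_cons, List.prod_cons, Equiv.Perm.mul_apply, ih,
      swapPerm_add_mul]

theorem prefixPerm_inv_succ (e : Equiv.Perm (Fin n)) (k : Fin n) (x : ℤ) :
    (prefixPerm e (k.val + 1))⁻¹ x = swapPerm (e k) ((prefixPerm e k.val)⁻¹ x) := by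
  rw [prefixPerm, take_succ_ofFn, List.map_append, List.prod_append, mul_inv_rev,
    List.map_singleton, List.prod_singleton, swapPerm_inv]
  rfl

theorem coxPerm_eq (e : Equiv.Perm (Fin n)) :
    coxPerm e = ((List.ofFn e).reverse.map swapPerm).prod := by
  rw [coxPerm, prefixPerm, List.take_of_length_le (by simp), List.prod_inv_reverse, List.map_map,
    List.map_reverse]
  rfl

theorem coxeter_eps (e : Equiv.Perm (Fin n)) (x y : ℤ) :
    coxeter e (eps n y - eps n x) = eps n (coxPerm e y) - eps n (coxPerm e x) := by
  rw [coxPerm_eq]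
  exact prod_map_simpleReflection_eps _ _ _

theorem coxeter_pow_eps (e : Equiv.Perm (Fin n)) (k : ℕ) (x y : ℤ) :
    (coxeter e ^ k) (eps n y - eps n x) = eps n ((coxPerm e ^ k) y) - eps n ((coxPerm e ^ k) x) := by
  induction k with
  | zero => rfl
  | succ k ih => rw [pow_succ', pow_succ', LinearEquiv.mul_apply, ih, coxeter_eps]; rfl

theorem coxeter_inv_eps (e : Equiv.Perm (Fin n)) (x y : ℤ) :
    (coxeter e)⁻¹ (eps n y - eps n x) = eps n ((coxPerm e)⁻¹ y) - eps n ((coxPerm e)⁻¹ x) := by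
  have := coxeter_eps e ((coxPerm e)⁻¹ x) ((coxPerm e)⁻¹ y)
  simp only [Equiv.Perm.coe_inv, Equiv.apply_symm_apply] at this
  exact (LinearEquiv.symm_apply_eq _).2 this.symm

theorem coxPerm_mirror (e : Equiv.Perm (Fin n)) (x : ℤ) : coxPerm e (1 - x) = 1 - coxPerm e x := by
  rw [coxPerm_eq, prod_map_swapPerm_mirror]

theorem coxPerm_add_mul (e : Equiv.Perm (Fin n)) (x q : ℤ) :
    coxPerm e (x + period n * q) = coxPerm e x + period n * q := by
  rw [coxPerm_eq, prod_map_swapPerm_add_mul]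

theorem rising_mirror (e : Equiv.Perm (Fin n)) (x : ℤ) : Rising e (1 - x) ↔ ¬ Rising e x := by
  have h1 : foldVertex n (1 - x) = foldVertex n (x - 1) := by rw [← foldVertex_neg]; ring_nf
  have h2 : foldVertex n (1 - x - 1) = foldVertex n x := by rw [← foldVertex_neg]; ring_nf
  have h4 := e.symm.injective.ne (foldVertex_pred_ne (n := n) x)
  rw [Rising, Rising, h1, h2, not_lt]
  exact ⟨le_of_lt, fun h => lt_of_le_of_ne h h4⟩

theorem rising_add_mul (e : Equiv.Perm (Fin n)) (x q : ℤ) :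
    Rising e (x + period n * q) ↔ Rising e x := by
  rw [Rising, Rising, foldVertex_add_mul, show x + period n * q - 1 = x - 1 + period n * q by ring,
    foldVertex_add_mul]

/-- An invariant for the path of `x` under the first `m` reflections. All vertices passed have had
their turn; the current one either still awaits its turn or precedes its left neighbour in the
sequence, and then the point has stopped at a rising position. -/
theorem prefixPerm_inv_rising (e : Equiv.Perm (Fin n)) {x : ℤ} (hx : Rising e x) (m : ℕ)
    (hm : m ≤ n) :
    x ≤ (prefixPerm e m)⁻¹ x ∧
    (∀ z, x ≤ z → z < (prefixPerm e m)⁻¹ x → (e.symm (foldVertex n z)).val < m) ∧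
    (∀ z, x < z → z < (prefixPerm e m)⁻¹ x → ¬ Rising e z) ∧
    (m ≤ (e.symm (foldVertex n ((prefixPerm e m)⁻¹ x))).val ∨
      x < (prefixPerm e m)⁻¹ x ∧ Rising e ((prefixPerm e m)⁻¹ x)) := by
  induction m with
  | zero => simp [prefixPerm]; omega
  | succ m ih =>
    obtain ⟨h1, h2, h4, h5⟩ := ih (by omega)
    rw [prefixPerm_inv_succ e ⟨m, by omega⟩]
    change x ≤ swapPerm _ ((prefixPerm e m)⁻¹ x) ∧ _
    generalize (prefixPerm e m)⁻¹ x = y at *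
    set v := e ⟨m, by omega⟩ with hv
    have hsymm : ∀ z, foldVertex n z = v ↔ (e.symm (foldVertex n z)).val = m := by
      intro z
      rw [hv, ← Equiv.symm_apply_eq, Fin.ext_iff]
    rw [swapPerm_apply]
    split_ifs with h6 h7
    · rw [hsymm] at h6
      refine ⟨by omega, fun z hz hz' => ?_, fun z hz hz' => ?_, ?_⟩
      · rcases eq_or_lt_of_le (Int.le_of_lt_add_one hz') with rfl | h
        · omega
        · have := h2 z hz h; omega
      · rcases eq_or_lt_of_le (Int.le_of_lt_add_one hz') with rfl | h
        · have := h2 (z - 1) (by omega) (by omega)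
          rw [Rising, Fin.lt_def]
          omega
        · exact h4 z hz h
      · have h8 := Fin.val_injective.ne
          (e.symm.injective.ne (foldVertex_succ_ne (n := n) y))
        rw [Rising, add_sub_cancel_right, Fin.lt_def]
        omega
    · rw [hsymm] at h6 h7
      exfalso
      rcases eq_or_lt_of_le h1 with rfl | h
      · rw [Rising, Fin.lt_def] at hx
        omega
      · have := h2 (y - 1) (by omega) (by omega)
        omega
    · rw [hsymm] at h6 h7
      refine ⟨h1, fun z hz hz' => ?_, h4, ?_⟩
      · have := h2 z hz hz'; omega
      · exact h5.imp_left (by omega)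

/-- On rising positions the Coxeter element moves to the next rising position. -/
theorem coxPerm_rising (e : Equiv.Perm (Fin n)) {x : ℤ} (hx : Rising e x) :
    x < coxPerm e x ∧ Rising e (coxPerm e x) ∧
      ∀ z, x < z → z < coxPerm e x → ¬ Rising e z := by
  obtain ⟨-, -, h1, h2⟩ := prefixPerm_inv_rising e hx n le_rfl
  have h4 := (e.symm (foldVertex n ((prefixPerm e n)⁻¹ x))).isLt
  rw [or_iff_right (by omega)] at h2
  exact ⟨h2.1, h2.2, h1⟩

theorem coxPerm_not_rising (e : Equiv.Perm (Fin n)) {x : ℤ} (hx : ¬ Rising e x) :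
    coxPerm e x < x ∧ ¬ Rising e (coxPerm e x) := by
  rw [← rising_mirror] at hx ⊢
  have := coxPerm_rising e hx
  rw [coxPerm_mirror] at this
  exact ⟨by omega, this.2.1⟩

theorem rising_coxPerm_iff (e : Equiv.Perm (Fin n)) (x : ℤ) :
    Rising e (coxPerm e x) ↔ Rising e x :=
  ⟨fun h => by_contra fun hx => (coxPerm_not_rising e hx).2 h, fun h => (coxPerm_rising e h).2.1⟩

theorem coxPerm_pow_rising (e : Equiv.Perm (Fin n)) {x : ℤ} (hx : Rising e x) (k : ℕ) :
    Rising e ((coxPerm e ^ k) x) := by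
  induction k with
  | zero => exact hx
  | succ k ih => rw [pow_succ', Equiv.Perm.mul_apply, rising_coxPerm_iff]; exact ih

theorem coxPerm_pow_add_mul (e : Equiv.Perm (Fin n)) (k : ℕ) (x q : ℤ) :
    (coxPerm e ^ k) (x + period n * q) = (coxPerm e ^ k) x + period n * q := by
  induction k with
  | zero => rfl
  | succ k ih => simp only [pow_succ', Equiv.Perm.mul_apply, ih, coxPerm_add_mul]

theorem lt_coxPerm_pow (e : Equiv.Perm (Fin n)) {x : ℤ} (hx : Rising e x) {j k : ℕ} (h : j < k) :
    (coxPerm e ^ j) x < (coxPerm e ^ k) x := by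
  induction k, h using Nat.le_induction with
  | base =>
    rw [pow_succ', Equiv.Perm.mul_apply]
    exact (coxPerm_rising e (coxPerm_pow_rising e hx j)).1
  | succ k _ ih =>
    refine ih.trans ?_
    rw [pow_succ', Equiv.Perm.mul_apply]
    exact (coxPerm_rising e (coxPerm_pow_rising e hx k)).1

theorem exists_coxPerm_pow_eq (e : Equiv.Perm (Fin n)) (m : ℕ) : ∀ x y : ℤ, y - x = m →
    Rising e x → Rising e y → ∃ k : ℕ, (coxPerm e ^ k) x = y := by
  induction m using Nat.strong_induction_on with
  | _ m ih =>
    intro x y hm hx hy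
    rcases Nat.eq_zero_or_pos m with rfl | hm0
    · exact ⟨0, by rw [pow_zero, Equiv.Perm.one_apply]; omega⟩
    obtain ⟨h1, h2, h4⟩ := coxPerm_rising e hx
    have h5 : coxPerm e x ≤ y := by
      by_contra! h
      exact h4 y (by omega) h hy
    obtain ⟨k, hk⟩ := ih (y - coxPerm e x).toNat (by omega) (coxPerm e x) y (by omega) h2 hy
    exact ⟨k + 1, by rw [pow_succ, Equiv.Perm.mul_apply, hk]⟩

open Classical in
/-- There are `n - 1` rising positions in each period. -/
theorem coxPerm_pow_period (e : Equiv.Perm (Fin n)) {x : ℤ} (hx : Rising e x) :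
    (coxPerm e ^ (n - 1)) x = x + period n := by
  have h := h3.out
  obtain ⟨k, hk⟩ := exists_coxPerm_pow_eq e (period n) x (x + period n) (by ring) hx
    (by simpa using (rising_add_mul e x 1).mpr hx)
  -- `g` counts rising positions, so `k` is their number in any period.
  let g : ℤ → ℤ := potential fun z => if Rising e z then 1 else 0
  have hg : ∀ z, g (z + 1) = g z + if Rising e z then 1 else 0 := potential_succ _
  have hconst : ∀ a b : ℤ, a ≤ b → (∀ z, a ≤ z → z < b → ¬ Rising e z) → g b = g a := by
    intro a b hab
    induction b, hab using Int.leInduction with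
    | base => intro _; rfl
    | succ b hab ih =>
      intro hz
      rw [hg, if_neg (hz b hab (by omega)), add_zero]
      exact ih fun z h1 h2 => hz z h1 (by omega)
  have hstep : ∀ z, Rising e z → g (coxPerm e z) = g z + 1 := by
    intro z hz
    obtain ⟨h1, -, h2⟩ := coxPerm_rising e hz
    rw [hconst (z + 1) _ (by omega) fun w h4 h5 => h2 w (by omega) h5, hg, if_pos hz]
  have hpow : ∀ j : ℕ, g ((coxPerm e ^ j) x) = g x + j := by
    intro j
    induction j with
    | zero => simp
    | succ j ih =>
      rw [pow_succ', Equiv.Perm.mul_apply, hstep _ (coxPerm_pow_rising e hx j), ih]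
      push_cast; ring
  have hper : ∀ a, g (a + period n) - g a = k := by
    intro a
    have h1 := sub_eq_sub_of_succ (fun z => g (z + period n)) g (fun z => by
      have := rising_add_mul e z 1
      rw [mul_one] at this
      simp only [show z + 1 + period n = z + period n + 1 by ring, hg, this]
      ring) x a
    have h2 := hpow k
    rw [hk] at h2
    linarith
  -- The mirror exchanges rising and non-rising positions, so both kinds are equally frequent and `2
  -- * k` is the period.
  have hmir := sub_eq_sub_of_succ (fun z => g (1 - z)) (fun z => g (z + 1) - z) (fun z => by
    have h1 := hg (-z)
    have h2 := hg (z + 1)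
    have h4 := rising_mirror e (z + 1)
    rw [show 1 - (z + 1) = -z by ring] at h4
    simp only [show 1 - (z + 1) = -z by ring, show 1 - z = -z + 1 by ring, h1, h2, h4]
    split_ifs <;> ring) x (x + period n)
  have h1 := hper (1 - x - period n)
  have h2 := hper (x + 1)
  simp only [show 1 - (x + period n) = 1 - x - period n by ring,
    show x + period n + 1 = x + 1 + period n by ring] at hmir
  rw [sub_add_cancel] at h1
  have h4 : (2 * k : ℤ) = period n := by linarith
  have h5 : k = n - 1 := by unfold period at h4; omega
  rw [← h5, hk]

end

/-! ### Signs of `beta` and `gamma` -/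

theorem coroot_apply {n : ℕ} (a : Fin n) (u : Fin n → ℤ) :
    coroot a u = ∑ j, cartanMatrix n a j * u j := rfl

theorem cartanMatrix_nonpos {n : ℕ} {i j : Fin n} (h : i ≠ j) : cartanMatrix n i j ≤ 0 := by
  simp only [cartanMatrix, Matrix.of_apply, if_neg h]
  split_ifs <;> norm_num

/-- Before reflecting at a new vertex `a`, the coordinate at `a` is zero and the others are
nonnegative. The coroot is thus nonpositive, and a nonnegative multiple of the simple root is added.
-/
theorem prod_map_simpleReflection_nonneg {n : ℕ} (v : Fin n) (l : List (Fin n)) (hl : l.Nodup)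
    (hv : v ∉ l) :
    (∀ j, 0 ≤ (l.map simpleReflection).prod (simpleRoot v) j) ∧
    ∀ j, j ≠ v → j ∉ l → (l.map simpleReflection).prod (simpleRoot v) j = 0 := by
  induction l with
  | nil =>
    simp only [List.map_nil, List.prod_nil, LinearEquiv.coe_one, id_eq, simpleRoot, Pi.single_apply]
    exact ⟨fun j => by split_ifs <;> norm_num, fun j hj _ => if_neg hj⟩
  | cons a l ih =>
    rw [List.nodup_cons] at hl
    rw [List.mem_cons, not_or] at hv
    obtain ⟨h1, h2⟩ := ih hl.2 hv.2
    rw [List.map_cons, List.prod_cons, LinearEquiv.mul_apply]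
    generalize (l.map simpleReflection).prod (simpleRoot v) = u at *
    have ha : coroot a u ≤ 0 := by
      rw [coroot_apply]
      refine Finset.sum_nonpos fun j _ => ?_
      rcases eq_or_ne a j with rfl | h
      · rw [h2 a (Ne.symm hv.1) hl.1, mul_zero]
      · exact mul_nonpos_of_nonpos_of_nonneg (cartanMatrix_nonpos h) (h1 j)
    have e : ∀ j, simpleReflection a u j = u j - coroot a u * (if j = a then 1 else 0) := by
      intro j
      rw [simpleReflection, Module.reflection_apply, simpleRoot, Pi.sub_apply, Pi.smul_apply,
        Pi.single_apply, smul_eq_mul]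
    constructor
    · intro j
      rw [e]
      have := h1 j
      split_ifs <;> omega
    · intro j hj hj'
      rw [List.mem_cons, not_or] at hj'
      rw [e, if_neg hj'.1, h2 j hj hj'.2]
      ring

theorem simpleReflection_simpleRoot_self {n : ℕ} (v : Fin n) :
    simpleReflection v (simpleRoot v) = -simpleRoot v := by
  rw [simpleReflection_simpleRoot]
  simp [cartanMatrix, two_smul]

theorem ofFn_rev {n : ℕ} {A : Type*} (f : Fin n → A) :
    List.ofFn (f ∘ Fin.rev) = (List.ofFn f).reverse := by
  apply List.ext_getElem (by simp)
  intro k h1 h2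
  simp only [List.getElem_ofFn, List.getElem_reverse, Function.comp_apply, List.length_ofFn]
  congr 1
  ext
  simp
  omega

/-- Reversing the sequence also inverts the Coxeter element, so results on `gamma` follow from those
on `beta`. -/
theorem gamma_eq_beta_rev {n : ℕ} (i : Fin n → Fin n) (k : Fin n) :
    gamma i k = beta (i ∘ Fin.rev) k.rev := by
  rw [gamma, beta, ofFn_rev, List.take_reverse, Function.comp_apply, Fin.rev_rev, List.length_ofFn,
    Fin.val_rev, show n - (n - (k.val + 1)) = k.val + 1 by omega]

theorem coxeter_rev {n : ℕ} (i : Fin n → Fin n) : coxeter (i ∘ Fin.rev) = (coxeter i)⁻¹ := by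
  rw [coxeter, coxeter, ofFn_rev, List.reverse_reverse, List.prod_inv_reverse, List.map_map,
    ← List.map_reverse, List.reverse_reverse]
  congr 2

/-- The prefix of `c` cancels against that of `beta`, and the `k`-th reflection negates its simple
root. -/
theorem coxeter_beta {n : ℕ} (i : Fin n → Fin n) (k : Fin n) : coxeter i (beta i k) = -gamma i k := by
  have h : coxeter i * (((List.ofFn i).take k.val).map simpleReflection).prod =
      (((List.ofFn i).drop (k.val + 1)).reverse.map simpleReflection).prod *
        simpleReflection (i k) := by
    have e : (List.ofFn i).reverse = ((List.ofFn i).drop (k.val + 1)).reverse ++ [i k] ++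
        ((List.ofFn i).take k.val).reverse := by
      conv_lhs => rw [← List.take_append_drop (k.val + 1) (List.ofFn i), take_succ_ofFn]
      simp
    have e' : (((List.ofFn i).take k.val).map simpleReflection).prod =
        ((((List.ofFn i).take k.val).reverse.map simpleReflection).prod)⁻¹ := by
      rw [List.prod_inv_reverse, List.map_map, ← List.map_reverse, List.reverse_reverse]
      congr 2
    rw [coxeter, e, e', List.map_append, List.map_append, List.prod_append, List.prod_append,
      mul_inv_cancel_right, List.map_singleton, List.prod_singleton]
  rw [beta, gamma, ← LinearEquiv.mul_apply, h, LinearEquiv.mul_apply,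
    simpleReflection_simpleRoot_self, map_neg]

theorem beta_nonneg {n : ℕ} {i : Fin n → Fin n} (hi : Function.Injective i) (k j : Fin n) :
    0 ≤ beta i k j := by
  have hd : ((List.ofFn i).take k.val ++ [i k]).Nodup := by
    rw [← take_succ_ofFn]
    exact (List.nodup_ofFn.mpr hi).sublist (List.take_sublist _ _)
  rw [List.nodup_append] at hd
  exact (prod_map_simpleReflection_nonneg (i k) _ hd.1 fun h =>
    hd.2.2 _ h _ (List.mem_singleton_self _) rfl).1 j

theorem gamma_nonneg {n : ℕ} {i : Fin n → Fin n} (hi : Function.Injective i) (k j : Fin n) :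
    0 ≤ gamma i k j := by
  rw [gamma_eq_beta_rev]
  exact beta_nonneg (hi.comp Fin.rev_injective) _ _

/-! ### The families in unfolded coordinates -/

section

variable {n : ℕ} [h3 : Fact (3 ≤ n)]

/-- A positive root made negative by the Coxeter element is one of the `beta e k`. -/
theorem exists_eq_beta (e : Equiv.Perm (Fin n)) {x y : ℤ} (hxy : x < y)
    (h : coxPerm e y < coxPerm e x) : ∃ k, eps n y - eps n x = beta e k := by
  -- The order of the two ends is reversed at the end, hence at some single reflection.
  have hstep : ∃ k : Fin n, (prefixPerm e k.val)⁻¹ x < (prefixPerm e k.val)⁻¹ y ∧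
      (prefixPerm e (k.val + 1))⁻¹ y ≤ (prefixPerm e (k.val + 1))⁻¹ x := by
    by_contra! hne
    have : ∀ m : ℕ, m ≤ n → (prefixPerm e m)⁻¹ x < (prefixPerm e m)⁻¹ y := by
      intro m
      induction m with
      | zero => intro _; simpa [prefixPerm] using hxy
      | succ m ih => intro hm; exact hne ⟨m, by omega⟩ (ih (by omega))
    exact absurd (this n le_rfl) (not_lt.mpr h.le)
  obtain ⟨k, h1, h2⟩ := hstep
  refine ⟨k, ?_⟩
  have hx : x = prefixPerm e k ((prefixPerm e k)⁻¹ x) :=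
    ((prefixPerm e k).apply_symm_apply x).symm
  have hy : y = prefixPerm e k ((prefixPerm e k)⁻¹ y) :=
    ((prefixPerm e k).apply_symm_apply y).symm
  rw [prefixPerm_inv_succ, prefixPerm_inv_succ] at h2
  rw [hx, hy]
  generalize (prefixPerm e k)⁻¹ x = u at *
  generalize (prefixPerm e k)⁻¹ y = w at *
  -- Adjacent swaps can reverse only a swapped pair, so just before step `k` the root is simple.
  have key : w = u + 1 ∧ foldVertex n u = e k := by
    have hne : swapPerm (e k) w ≠ swapPerm (e k) u := fun h => by
      have := (swapPerm (e k)).injective h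
      omega
    rw [swapPerm_apply, swapPerm_apply] at h2 hne
    by_cases hw : w = u + 1
    · subst hw
      refine ⟨rfl, ?_⟩
      by_contra hu
      rw [add_sub_cancel_right, if_neg hu, if_neg hu] at h2
      split_ifs at h2 <;> omega
    · split_ifs at h2 hne <;> omega
  obtain ⟨rfl, hk⟩ := key
  rw [beta, ← hk, simpleRoot_eq_eps, prod_map_simpleReflection_eps]
  rfl

/-- By `coxeter_beta` and `gamma_nonneg`, `c` reverses the order of the ends. It preserves the order
of two ends of equal kind, and drives a non-rising left end away from a rising right end, so one
pattern remains. -/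
theorem beta_eq_eps_sub (e : Equiv.Perm (Fin n)) (k : Fin n) :
    ∃ x y, x < y ∧ Rising e x ∧ ¬ Rising e y ∧ beta e k = eps n y - eps n x := by
  have hinj : ∀ {τ : Equiv.Perm ℤ} {x y : ℤ}, x ≠ y → τ x ≠ τ y := fun h => Equiv.injective _ |>.ne h
  obtain ⟨x, y, hne, hb⟩ : ∃ x y, x ≠ y ∧ beta e k = eps n y - eps n x := by
    refine ⟨prefixPerm e k.val (e k).val, prefixPerm e k.val ((e k).val + 1), hinj (by omega), ?_⟩
    rw [beta]
    simp only [prefixPerm]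
    rw [← prod_map_simpleReflection_eps, ← simpleRoot_eq_eps, foldVertex_natCast]
  have hlt : x < y := lt_of_eps_sub_nonneg hne fun i => by
    rw [← hb]; exact beta_nonneg e.injective k i
  have hlt' : coxPerm e y < coxPerm e x := lt_of_eps_sub_nonneg (hinj hne.symm) fun i => by
    have h1 := gamma_nonneg e.injective k i
    have h2 := congrFun (coxeter_beta e k) i
    rw [hb, coxeter_eps] at h2
    simp only [Pi.sub_apply, Pi.neg_apply] at h2 ⊢
    omega
  by_cases hx : Rising e x <;> by_cases hy : Rising e y
  · obtain ⟨h1, -, h2⟩ := coxPerm_rising e hx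
    have h4 := (coxPerm_rising e hy).1
    exact absurd hy (h2 y hlt (by omega))
  · exact ⟨x, y, hlt, hx, hy, hb⟩
  · have h1 := (coxPerm_rising e hy).1
    have h2 := (coxPerm_not_rising e hx).1
    omega
  · rw [← rising_mirror] at hx hy
    obtain ⟨h1, -, h2⟩ := coxPerm_rising e hy
    have h4 := (coxPerm_rising e hx).1
    rw [coxPerm_mirror] at h1 h2 h4
    exact absurd hx (h2 (1 - x) (by omega) (by omega))

/-- The positive roots in the orbits of the `beta e k` under the inverse Coxeter element. -/
theorem setOf_coxeter_inv_pow_beta (e : Equiv.Perm (Fin n)) :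
    {v | ∃ (r : ℕ) (k : Fin n), v = ((coxeter e)⁻¹ ^ r) (beta e k)} =
      {v | ∃ x y, x < y ∧ Rising e x ∧ ¬ Rising e y ∧ v = eps n y - eps n x} := by
  ext v
  constructor
  · rintro ⟨r, k, rfl⟩
    induction r with
    | zero => exact beta_eq_eps_sub e k
    | succ r ih =>
      obtain ⟨x, y, hlt, hx, hy, h⟩ := ih
      refine ⟨(coxPerm e)⁻¹ x, (coxPerm e)⁻¹ y, ?_, ?_, ?_, ?_⟩
      all_goals
        have ex : coxPerm e ((coxPerm e)⁻¹ x) = x := (coxPerm e).apply_symm_apply x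
        have ey : coxPerm e ((coxPerm e)⁻¹ y) = y := (coxPerm e).apply_symm_apply y
        have hx' : Rising e ((coxPerm e)⁻¹ x) := by rwa [← rising_coxPerm_iff, ex]
        have hy' : ¬ Rising e ((coxPerm e)⁻¹ y) := by rwa [← rising_coxPerm_iff, ey]
      · have h1 := (coxPerm_rising e hx').1
        have h2 := (coxPerm_not_rising e hy').1
        omega
      · exact hx'
      · exact hy'
      · rw [pow_succ', LinearEquiv.mul_apply, h, coxeter_inv_eps]
  · rintro ⟨x, y, hlt, hx, hy, rfl⟩
    -- Each application of `c` shrinks the gap; the last root before the ends cross is some `beta e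
    -- k`.
    obtain ⟨m, hm⟩ : ∃ m : ℕ, y - x = m := ⟨(y - x).toNat, by omega⟩
    induction m using Nat.strong_induction_on generalizing x y with
    | _ m ih =>
      rcases lt_trichotomy (coxPerm e x) (coxPerm e y) with h | h | h
      · have h1 := coxPerm_rising e hx
        have h2 := coxPerm_not_rising e hy
        obtain ⟨r, k, hr⟩ := ih (coxPerm e y - coxPerm e x).toNat (by omega) _ _ h h1.2.1 h2.2
          (by omega)
        refine ⟨r + 1, k, ?_⟩
        rw [← coxeter_eps] at hr
        rw [pow_succ', LinearEquiv.mul_apply, ← hr]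
        exact ((coxeter e).symm_apply_apply _).symm
      · have := (coxPerm e).injective h
        omega
      · obtain ⟨k, hk⟩ := exists_eq_beta e hlt h
        exact ⟨0, k, hk⟩

theorem rising_rev (e : Equiv.Perm (Fin n)) (x : ℤ) :
    Rising (Fin.revPerm.trans e) x ↔ ¬ Rising e x := by
  have h := e.symm.injective.ne (foldVertex_pred_ne (n := n) x)
  simp only [Rising, Equiv.symm_trans_apply, Fin.revPerm_symm, Fin.revPerm_apply, Fin.rev_lt_rev,
    not_lt]
  exact ⟨le_of_lt, fun h' => lt_of_le_of_ne h' h⟩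

/-- The positive roots in the orbits of the `gamma e k` under the Coxeter element. -/
theorem setOf_coxeter_pow_gamma (e : Equiv.Perm (Fin n)) :
    {v | ∃ (s : ℕ) (k : Fin n), v = (coxeter e ^ s) (gamma e k)} =
      {v | ∃ x y, x < y ∧ ¬ Rising e x ∧ Rising e y ∧ v = eps n y - eps n x} := by
  have h := setOf_coxeter_inv_pow_beta (Fin.revPerm.trans e)
  have hc : ⇑(Fin.revPerm.trans e) = e ∘ Fin.rev := rfl
  simp only [hc, coxeter_rev, inv_inv, rising_rev, not_not] at h
  rw [← h]
  ext v
  simp only [gamma_eq_beta_rev, Set.mem_ofPred_eq]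
  exact exists_congr fun s => (Fin.rev_surjective.exists
    (p := fun k => v = (coxeter e ^ s) (beta (e ∘ Fin.rev) k))).symm

/-- The roots of the non-homogeneous tube. -/
theorem setOf_tube (e : Equiv.Perm (Fin n)) {a : ℤ} (ha : Rising e a) {α : Fin n → ℤ}
    (hα : α = eps n (coxPerm e a) - eps n a) :
    {x | ∃ p q m : ℕ, p < n - 1 ∧ q < n - 2 ∧
        x = (∑ j ∈ Finset.Icc p (p + q), (coxeter e ^ j) α) + m • delta n} ∪
      {x | ∃ m : ℕ, 0 < m ∧ x = m • delta n} =
    {v | ∃ x y, x < y ∧ Rising e x ∧ Rising e y ∧ v = eps n y - eps n x} := by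
  have h := h3.out
  -- The sum telescopes along the orbit of `a`.
  have hsum : ∀ p q : ℕ, ∑ j ∈ Finset.Icc p (p + q), (coxeter e ^ j) α =
      eps n ((coxPerm e ^ (p + q + 1)) a) - eps n ((coxPerm e ^ p) a) := by
    intro p q
    have h1 : ∀ j, (coxeter e ^ j) α =
        eps n ((coxPerm e ^ (j + 1)) a) - eps n ((coxPerm e ^ j) a) := by
      intro j
      rw [hα, coxeter_pow_eps, pow_succ, Equiv.Perm.mul_apply]
    induction q with
    | zero => simp [h1]
    | succ q ih =>
      rw [← add_assoc, Finset.sum_Icc_succ_top (by omega), ih, h1]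
      abel
  have hdelta : ∀ (x : ℤ) (m : ℕ), m • delta n = eps n (x + period n * m) - eps n x := by
    intro x m
    rw [eps_add_period_mul, natCast_zsmul]
  have hperiod : (0 : ℤ) < period n := by unfold period; omega
  have hmul : ∀ (q : ℕ) {x : ℤ}, Rising e x →
      (coxPerm e ^ ((n - 1) * q)) x = x + period n * q := by
    intro q x hx
    induction q with
    | zero => simp
    | succ q ih =>
      rw [mul_add, mul_one, add_comm, pow_add, Equiv.Perm.mul_apply, ih, coxPerm_pow_add_mul,
        coxPerm_pow_period e hx]
      push_cast
      ring
  ext v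
  constructor
  · rintro (⟨p, q, m, hp, hq, rfl⟩ | ⟨m, hm, rfl⟩)
    · refine ⟨(coxPerm e ^ p) a, (coxPerm e ^ (p + q + 1)) a + period n * m, ?_,
        coxPerm_pow_rising e ha _, ?_, ?_⟩
      · have := lt_coxPerm_pow e ha (show p < p + q + 1 by omega)
        have : (0 : ℤ) ≤ period n * m := by positivity
        omega
      · rw [rising_add_mul]; exact coxPerm_pow_rising e ha _
      · rw [hsum, hdelta ((coxPerm e ^ (p + q + 1)) a)]
        abel
    · refine ⟨a, a + period n * m, ?_, ha, (rising_add_mul e a m).mpr ha, hdelta a m⟩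
      have : (0 : ℤ) < period n * m := by positivity
      omega
  · rintro ⟨x, y, hlt, hx, hy, rfl⟩
    obtain ⟨k, hk⟩ := exists_coxPerm_pow_eq e (y - x).toNat x y (by omega) hx hy
    have hk0 : k ≠ 0 := by
      rintro rfl
      rw [pow_zero, Equiv.Perm.one_apply] at hk
      -- The number `k` of steps from `x` to `y` is divided by `n - 1`: the quotient counts copies
      -- of `δ`, the remainder is the number of summands.
      omega
    have hdiv := Nat.div_add_mod k (n - 1)
    have hmod := Nat.mod_lt k (show 0 < n - 1 by omega)
    set m := k / (n - 1)
    set q := k % (n - 1)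
    have hy' : y = (coxPerm e ^ q) x + period n * m := by
      rw [← hk, ← hdiv, add_comm, pow_add, Equiv.Perm.mul_apply, hmul m hx, coxPerm_pow_add_mul]
    rcases Nat.eq_zero_or_pos q with hq | hq
    · right
      refine ⟨m, ?_, ?_⟩
      · rcases Nat.eq_zero_or_pos m with hm | hm
        · rw [hm, hq] at hdiv; simp at hdiv; omega
        · exact hm
      · rw [hdelta x, hy', hq, pow_zero, Equiv.Perm.one_apply]
    · left
      -- Natural powers of `c` reach only positions to the right of `a`; shifting both ends by
      -- periods leaves the root unchanged.
      obtain ⟨t, ht⟩ : ∃ t : ℕ, a ≤ x + period n * t := by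
        refine ⟨(a - x).toNat, ?_⟩
        have : ((a - x).toNat : ℤ) ≤ period n * (a - x).toNat := by nlinarith
        omega
      obtain ⟨s, hs⟩ := exists_coxPerm_pow_eq e (x + period n * t - a).toNat a (x + period n * t)
        (by omega) ha ((rising_add_mul e x t).mpr hx)
      have hsdiv := Nat.div_add_mod s (n - 1)
      have hsmod := Nat.mod_lt s (show 0 < n - 1 by omega)
      set u := s / (n - 1)
      set p := s % (n - 1)
      have hx' : x = (coxPerm e ^ p) a + period n * (u - t) := by
        rw [← hsdiv, add_comm, pow_add, Equiv.Perm.mul_apply, hmul u ha, coxPerm_pow_add_mul] at hs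
        linarith
      refine ⟨p, q - 1, m, hsmod, by omega, ?_⟩
      rw [hsum, show p + (q - 1) + 1 = q + p by omega, pow_add, Equiv.Perm.mul_apply,
        hdelta ((coxPerm e ^ q) ((coxPerm e ^ p) a)), hy', hx', coxPerm_pow_add_mul]
      have := eps_add_mul_sub (n := n) ((coxPerm e ^ p) a)
        ((coxPerm e ^ q) ((coxPerm e ^ p) a) + period n * m) (u - t)
      rw [show ∀ z : ℤ, z + period n * (u - t) + period n * m = z + period n * m + period n * (u - t)
        from fun z => by ring, this]
      abel

end

/-! ### From the orientation to the rising positions -/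

theorem mem_foldl_reflectOrientation {n : ℕ} {a : Fin n × Fin n} (l : List (Fin n)) :
    ∀ {Ω : Set (Fin n × Fin n)}, a ∈ Ω → (∀ v ∈ l, a.1 ≠ v ∧ a.2 ≠ v) →
      a ∈ l.foldl (fun Ω' v => reflectOrientation v Ω') Ω := by
  induction l with
  | nil => intro Ω ha _; exact ha
  | cons v l ih =>
    intro Ω ha hl
    rw [List.foldl_cons]
    exact ih (Or.inl ⟨ha, hl v (List.mem_cons_self)⟩) fun w hw => hl w (List.mem_cons_of_mem _ hw)

/-- In a `+`-admissible sequence the target of an arrow comes before its source. -/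
theorem IsPlusAdmissible.symm_lt {n : ℕ} {Ω : Set (Fin n × Fin n)} (hΩ : IsOrientation Ω)
    {e : Equiv.Perm (Fin n)} (he : IsPlusAdmissible Ω e) {v w : Fin n} (h : (v, w) ∈ Ω) :
    e.symm v < e.symm w := by
  by_contra! hle
  have hne : v ≠ w := by
    rintro rfl
    exact hΩ.acyclic v (Relation.TransGen.single h)
  have hlt : e.symm w < e.symm v := lt_of_le_of_ne hle (e.symm.injective.ne hne.symm)
  -- At the turn of `w` the arrow `w → v` is still unreversed, so `w` is not a sink.
  refine he.sink (e.symm w) v ?_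
  rw [Equiv.apply_symm_apply]
  refine mem_foldl_reflectOrientation _ h fun u hu => ?_
  obtain ⟨j, hj, rfl⟩ := List.getElem_of_mem hu
  rw [List.length_take, List.length_ofFn, lt_min_iff] at hj
  rw [List.getElem_take, List.getElem_ofFn]
  constructor <;> intro hc <;> rw [Fin.lt_def] at hlt <;> dsimp only at hc
  · rw [hc, Equiv.symm_apply_apply] at hlt
    dsimp only at hlt
    omega
  · have := hj.1
    rw [hc, Equiv.symm_apply_apply] at this
    dsimp only at this
    omega

section

variable {n : ℕ} [h3 : Fact (3 ≤ n)]

theorem cartanMatrix_foldVertex_neg_iff (v : Fin n) (k : ℤ) :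
    cartanMatrix n v (foldVertex n k) < 0 ↔ foldVertex n (k - 1) = v ∨ foldVertex n (k + 1) = v := by
  have h1 := foldVertex_pred_ne (n := n) k
  have h2 := foldVertex_succ_ne (n := n) k
  rw [cartanMatrix_foldVertex]
  by_cases h : foldVertex n k = v
  · rw [h] at h1 h2
    simp [h, h1, h2]
  · rw [if_neg h]
    split_ifs <;> simp_all

/-- A sink precedes both its neighbours in the sequence and a source follows both. -/
theorem rising_succ_of_isAdmissible {Ω : Set (Fin n × Fin n)} (hΩ : IsOrientation Ω)
    {e : Equiv.Perm (Fin n)} (he : IsPlusAdmissible Ω e) {l : ℤ}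
    (hl : IsAdmissible Ω (foldVertex n l)) : Rising e (l + 1) ↔ ¬ Rising e l := by
  have h1 := (hΩ.adj_iff _ _).mpr
    ((cartanMatrix_foldVertex_neg_iff (foldVertex n (l - 1)) l).mpr (Or.inl rfl))
  have h2 := (hΩ.adj_iff _ _).mpr
    ((cartanMatrix_foldVertex_neg_iff (foldVertex n (l + 1)) l).mpr (Or.inr rfl))
  rw [Rising, Rising, add_sub_cancel_right]
  rcases hl with hl | hl
  · have h4 := he.symm_lt hΩ (h1.resolve_left (hl _))
    have h5 := he.symm_lt hΩ (h2.resolve_left (hl _))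
    simp [h4, h5.le]
  · have h4 := he.symm_lt hΩ (h1.resolve_right (hl _))
    have h5 := he.symm_lt hΩ (h2.resolve_right (hl _))
    simp [h4.le, h5]

/-- An incoming and an outgoing arrow lead to distinct neighbours, one earlier and one later in the
sequence. -/
theorem rising_succ_of_not_isAdmissible {Ω : Set (Fin n × Fin n)} (hΩ : IsOrientation Ω)
    {e : Equiv.Perm (Fin n)} (he : IsPlusAdmissible Ω e) {l : ℤ}
    (hl : ¬ IsAdmissible Ω (foldVertex n l)) : Rising e (l + 1) ↔ Rising e l := by
  simp only [IsAdmissible, IsSink, IsSource, not_or, not_forall, not_not] at hl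
  obtain ⟨⟨j, hj⟩, k, hk⟩ := hl
  have hj' := he.symm_lt hΩ hj
  have hk' := he.symm_lt hΩ hk
  have h1 := (cartanMatrix_foldVertex_neg_iff j l).mp ((hΩ.adj_iff _ _).mp (Or.inl hj))
  have h2 := (cartanMatrix_foldVertex_neg_iff k l).mp ((hΩ.adj_iff _ _).mp (Or.inr hk))
  have hne : j ≠ k := by
    rintro rfl
    exact lt_asymm hj' hk'
  rw [Rising, Rising, add_sub_cancel_right]
  rcases h1 with rfl | rfl <;> rcases h2 with rfl | rfl
  · exact absurd rfl hne
  · exact iff_of_false hk'.asymm hj'.asymm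
  · exact iff_of_true hj' hk'
  · exact absurd rfl hne

theorem eq_coxPerm_of_next {e : Equiv.Perm (Fin n)} {a b : ℤ} (ha : Rising e a) (hb : Rising e b)
    (hab : a < b) (h : ∀ z, a < z → z < b → ¬ Rising e z) : b = coxPerm e a := by
  obtain ⟨h1, h2, h4⟩ := coxPerm_rising e ha
  rcases lt_trichotomy b (coxPerm e a) with h5 | h5 | h5
  · exact absurd hb (h4 b hab h5)
  · exact h5
  · exact absurd h2 (h _ h1 h5)

/-- The difference of consecutive positions of the same kind generates the tube. -/
theorem exists_rising_of_consecutive {e : Equiv.Perm (Fin n)} {a b : ℤ} (hab : a < b)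
    (h : Rising e b ↔ Rising e a) (hz : ∀ z, a < z → z < b → ¬ (Rising e z ↔ Rising e a)) :
    ∃ x, Rising e x ∧ eps n b - eps n a = eps n (coxPerm e x) - eps n x := by
  by_cases ha : Rising e a
  · refine ⟨a, ha, ?_⟩
    rw [← eq_coxPerm_of_next ha (h.mpr ha) hab fun z h1 h2 h4 =>
      hz z h1 h2 (iff_of_true h4 ha)]
  -- The mirror turns the non-rising pair `a < b` into the rising pair `1 - b < 1 - a`.
  · refine ⟨1 - b, (rising_mirror e b).mpr (mt h.mp ha), ?_⟩
    rw [← eq_coxPerm_of_next ((rising_mirror e b).mpr (mt h.mp ha)) ((rising_mirror e a).mpr ha)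
      (by omega) fun z h1 h2 h4 => hz (1 - z) (by omega) (by omega)
        (iff_of_false (mt (rising_mirror e z).mp (not_not.mpr h4)) ha), eps_mirror]

/-- In the alternating case the kinds alternate, so positions at distance two are consecutive of one
kind; at a non-admissible vertex, `l` and `l + 1` already agree. -/
theorem IsTubeRoot.exists_rising {Ω : Set (Fin n × Fin n)} (hΩ : IsOrientation Ω)
    {e : Equiv.Perm (Fin n)} (he : IsPlusAdmissible Ω e) {α : Fin n → ℤ} (hα : IsTubeRoot Ω α) :
    ∃ x, Rising e x ∧ α = eps n (coxPerm e x) - eps n x := by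
  rcases hα with ⟨hadm, i, j, hij, rfl⟩ | ⟨l, hl, rfl⟩
  · have e1 : simpleRoot i + simpleRoot j = eps n (i.val + 2 : ℤ) - eps n (i.val : ℤ) := by
      have h1 := simpleRoot_eq_eps (n := n) i.val
      have h2 := simpleRoot_eq_eps (n := n) j.val
      rw [foldVertex_natCast] at h1 h2
      rw [h1, h2, hij]
      push_cast
      rw [add_assoc, one_add_one_eq_two]
      abel
    rw [e1]
    have h1 := rising_succ_of_isAdmissible hΩ he (hadm (foldVertex n i.val))
    have h2 := rising_succ_of_isAdmissible hΩ he (hadm (foldVertex n (i.val + 1)))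
    rw [add_assoc, one_add_one_eq_two] at h2
    refine exists_rising_of_consecutive (by omega) (by tauto) fun z hz hz' => ?_
    obtain rfl : z = i.val + 1 := by omega
    tauto
  · rw [← foldVertex_natCast l] at hl ⊢
    rw [simpleRoot_eq_eps]
    refine exists_rising_of_consecutive (by omega) (rising_succ_of_not_isAdmissible hΩ he hl) ?_
    intro z hz hz'
    omega

end

end AffineC

/-! ### Assembling the families -/

theorem corollary4p5 (n : ℕ) (hn : 3 ≤ n) (Ω : Set (Fin n × Fin n))
    (hΩ : AffineC.IsOrientation Ω) (i : Fin n → Fin n) (hi : AffineC.IsPlusAdmissible Ω i)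
    (α : Fin n → ℤ) (hα : AffineC.IsTubeRoot Ω α) :
    AffineC.positiveRoots n =
      {x | ∃ (r : ℕ) (k : Fin n), x = ((AffineC.coxeter i)⁻¹ ^ r) (AffineC.beta i k)} ∪
      {x | ∃ (s : ℕ) (k : Fin n), x = (AffineC.coxeter i ^ s) (AffineC.gamma i k)} ∪
      {x | ∃ p q m : ℕ, p < n - 1 ∧ q < n - 2 ∧
        x = (∑ j ∈ Finset.Icc p (p + q), (AffineC.coxeter i ^ j) α) + m • AffineC.delta n} ∪
      {x | ∃ m : ℕ, 0 < m ∧ x = m • AffineC.delta n} := by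
  have : Fact (3 ≤ n) := ⟨hn⟩
  obtain ⟨e, rfl⟩ : ∃ e : Equiv.Perm (Fin n), ⇑e = i :=
    ⟨Equiv.ofBijective i (Finite.injective_iff_bijective.mp
      (Finite.injective_iff_surjective.mpr hi.surjective)), rfl⟩
  obtain ⟨a, ha, hαa⟩ := hα.exists_rising hΩ hi
  rw [Set.union_assoc, AffineC.setOf_tube e ha hαa, AffineC.setOf_coxeter_inv_pow_beta,
    AffineC.setOf_coxeter_pow_gamma, AffineC.positiveRoots_eq]
  ext v
  simp only [Set.mem_union, Set.mem_ofPred_eq]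
  constructor
  · rintro ⟨x, y, hlt, rfl⟩
    by_cases hx : AffineC.Rising e x <;> by_cases hy : AffineC.Rising e y
    · exact Or.inr ⟨x, y, hlt, hx, hy, rfl⟩
    · exact Or.inl (Or.inl ⟨x, y, hlt, hx, hy, rfl⟩)
    · exact Or.inl (Or.inr ⟨x, y, hlt, hx, hy, rfl⟩)
    -- Two non-rising ends become rising under the mirror, with the same root.
    · exact Or.inr ⟨1 - y, 1 - x, by omega, (AffineC.rising_mirror e y).mpr hy,
        (AffineC.rising_mirror e x).mpr hx, by rw [AffineC.eps_mirror]⟩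
  · rintro ((⟨x, y, hlt, -, -, rfl⟩ | ⟨x, y, hlt, -, -, rfl⟩) | ⟨x, y, hlt, -, -, rfl⟩) <;>
      exact ⟨x, y, hlt, rfl⟩
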